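/- All graphs are finite and simple. For a graph $G$ let $\alpha(G)$ be its independence number and $G^{\boxtimes n}$ its $n$-fold strong power: the vertices are the $n$-tuples of vertices of $G$, and two distinct tuples are adjacent iff in every coordinate their entries are equal or adjacent. The Shannon capacity of $G$ is $\mathscr C(G)=\lim_{n\to\infty}\alpha(G^{\boxtimes n})^{1/n}$. The Haemers number $\mathcal H(G)$ is the minimum, over all fields $K$, of the rank of a matrix $B\in K^{V(G)\times V(G)}$ with $B_{vv}\neq 0$ for all $v$ and $B_{uv}=0$ for all distinct nonadjacent $u,v$. Let $$\Gamma_0(G,H)=\min_f\max_{v\in V(G)}\frac1{|f(v)|}\in[0,\infty]\qquad(1/0=\infty),$$ where $f$ ranges over all maps assigning to each vertex of $G$ an independent set of $H$ (possibly empty) such that for distinct nonadjacent vertices $v_1,v_2$ of $G$ the sets $f(v_1),f(v_2)$ are disjoint and $f(v_1)\cup f(v_2)$ is independent in $H$. Let $C_m$ be the cycle of length $m$, and let $J(n,3)$ be the graph whose vertices are the $3$-subsets of $\{1,\dots,n\}$, two being adjacent iff they meet in exactly one element. Then: 1. For every integer $k\ge 1$, $\Gamma_0(C_{2k+1},J(4k+2,3))=\tfrac14$,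 and $$4\,\mathscr C(C_{2k+1})\le \mathscr C(J(4k+2,3))\le \mathcal H(J(4k+2,3)),\qquad \mathcal H(J(4k+2,3))\ge\lceil 4\,\mathscr C(C_{2k+1})\rceil .$$ 2. $\mathscr C(J(14,3))\ge 4\cdot 3.2578$, $\mathscr C(J(18,3))\ge 4\cdot 4.32$, $\mathscr C(J(22,3))\ge 4\cdot 5.2895$, $\mathscr C(J(26,3))\ge 4\cdot 6.2743$, and $\mathcal H(J(n,3))=n$ for $n=14,18,22,26$. 3. $\displaystyle\lim_{n\to\infty}\bigl(4n+2-\mathscr C(J(4n+2,3))\bigr)=0.$ -/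

import Mathlib

open Filter Topology
open scoped ENNReal

/-- The `n`-fold strong product of `G` with itself: two distinct `n`-tuples are adjacent iff in
every coordinate their entries are equal or adjacent. -/
def strongPow {V : Type*} (G : SimpleGraph V) (n : ℕ) : SimpleGraph (Fin n → V) where
  Adj x y := x ≠ y ∧ ∀ i, x i = y i ∨ G.Adj (x i) (y i)
  symm := ⟨fun _ _ h => ⟨h.1.symm, fun i => (h.2 i).imp Eq.symm fun a => a.symm⟩⟩
  loopless := ⟨fun _ h => h.1 rfl⟩

/-- The Shannon capacity `lim α(G^{⊠ n})^{1/n}`. The limit exists for every finite graph, see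
`tendsto_shannonCapacity`. -/
noncomputable def shannonCapacity {V : Type*} (G : SimpleGraph V) : ℝ :=
  limUnder atTop fun n : ℕ => ((strongPow G n).indepNum : ℝ) ^ (1 / (n : ℝ))

/-- The Haemers number: the least rank, over all fields, of a matrix with nonzero diagonal entries
and with zero entries at all pairs of distinct nonadjacent vertices. (For a finite graph the
entries of a matrix generate a countable subfield, so fields in `Type` suffice.) -/
noncomputable def haemersNumber {V : Type*} [Fintype V] (G : SimpleGraph V) : ℕ :=
  sInf {r | ∃ (K : Type) (_ : Field K) (B : Matrix V V K),
    (∀ v, B v v ≠ 0) ∧ (∀ u v, u ≠ v → ¬ G.Adj u v → B u v = 0) ∧ B.rank = r}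

/-- The graph `J(n,3)`: the vertices are the `3`-subsets of an `n`-set, adjacent iff they meet in
exactly one element. -/
def johnsonThree (n : ℕ) : SimpleGraph {s : Finset (Fin n) // s.card = 3} where
  Adj s t := (s.1 ∩ t.1).card = 1
  symm := ⟨fun s t h => by rw [Finset.inter_comm]; exact h⟩
  loopless := ⟨fun s h => by
    have := s.2
    rw [Finset.inter_self] at h
    omega⟩

/-- Two independent sets are disconnected if they are disjoint and their union is independent. -/
def DisconnectedSets {W : Type*} (H : SimpleGraph W) (S T : Finset W) : Prop :=
  Disjoint S T ∧ H.IsIndepSet ((S : Set W) ∪ (T : Set W))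

/-- The set `𝓕(H, G)` of assignments of independent sets of `H` to the vertices of `G` such that
distinct nonadjacent vertices of `G` receive disconnected sets. -/
def assignments {W V : Type*} (H : SimpleGraph W) (G : SimpleGraph V) : Set (V → Finset W) :=
  {f | (∀ v, H.IsIndepSet (f v : Set W)) ∧
    ∀ v₁ v₂, v₁ ≠ v₂ → ¬ G.Adj v₁ v₂ → DisconnectedSets H (f v₁) (f v₂)}

/-- `Γ₀(G, H) = min_f max_v 1 / |f v|` over `f ∈ 𝓕(H, G)`, with `1 / 0 = ∞`. For finite graphs the
infimum and the supremum range over finite sets. -/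
noncomputable def gammaZero {V W : Type*} (G : SimpleGraph V) (H : SimpleGraph W) : ℝ≥0∞ :=
  ⨅ f ∈ assignments H G, ⨆ v, 1 / ((f v).card : ℝ≥0∞)

/-- The independence number is supermultiplicative along strong powers. -/
theorem indepNum_strongPow_mul_le {V : Type*} [Finite V] (G : SimpleGraph V) (m n : ℕ) :
    (strongPow G m).indepNum * (strongPow G n).indepNum ≤ (strongPow G (m + n)).indepNum := by
  classical
  have := Fintype.ofFinite V
  obtain ⟨s, hs⟩ := (strongPow G m).exists_isNIndepSet_indepNum
  obtain ⟨t, ht⟩ := (strongPow G n).exists_isNIndepSet_indepNum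
  let e : (Fin m → V) × (Fin n → V) ≃ (Fin (m + n) → V) := Fin.appendEquiv m n
  rw [← hs.card_eq, ← ht.card_eq, ← Finset.card_product, ← Finset.card_map e.toEmbedding]
  refine SimpleGraph.IsIndepSet.card_le_indepNum ?_
  intro x hx y hy hxy hadj
  simp only [Finset.coe_map, Set.mem_image, Finset.mem_coe, Finset.mem_product] at hx hy
  obtain ⟨⟨a, b⟩, ⟨ha, hb⟩, rfl⟩ := hx
  obtain ⟨⟨c, d⟩, ⟨hc, hd⟩, rfl⟩ := hy
  have h1 : ∀ i, a i = c i ∨ G.Adj (a i) (c i) := fun i => by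
    simpa [e, Fin.appendEquiv] using hadj.2 (Fin.castAdd n i)
  have h2 : ∀ i, b i = d i ∨ G.Adj (b i) (d i) := fun i => by
    simpa [e, Fin.appendEquiv] using hadj.2 (Fin.natAdd m i)
  have hac : a = c := by
    by_contra hne
    exact hs.isIndepSet ha hc hne ⟨hne, h1⟩
  have hbd : b = d := by
    by_contra hne
    exact ht.isIndepSet hb hd hne ⟨hne, h2⟩
  exact hxy (by rw [hac, hbd])

/-- The limit that defines the Shannon capacity of a finite graph exists. -/
theorem tendsto_shannonCapacity {V : Type*} [Finite V] (G : SimpleGraph V) :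
    Tendsto (fun n : ℕ => ((strongPow G n).indepNum : ℝ) ^ (1 / (n : ℝ))) atTop
      (𝓝 (shannonCapacity G)) := by
  classical
  have := Fintype.ofFinite V
  refine tendsto_nhds_limUnder ?_
  rcases isEmpty_or_nonempty V with hV | hV
  · refine ⟨0, tendsto_const_nhds.congr' ?_⟩
    filter_upwards [eventually_ge_atTop 1] with n hn
    obtain ⟨s, hs⟩ := (strongPow G n).exists_isNIndepSet_indepNum
    have : IsEmpty (Fin n → V) := ⟨fun f => hV.elim (f ⟨0, hn⟩)⟩
    have hs0 : s = ∅ := Finset.eq_empty_of_isEmpty s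
    rw [← hs.card_eq, hs0]
    have hn' : (1 / (n : ℝ)) ≠ 0 := by positivity
    simp only [Finset.card_empty, Nat.cast_zero]
    rw [Real.zero_rpow hn']
  · have hpos : ∀ n, 1 ≤ (strongPow G n).indepNum := fun n => by
      have x : Fin n → V := fun _ => Classical.arbitrary V
      have h := SimpleGraph.IsIndepSet.card_le_indepNum (G := strongPow G n) (t := {x})
        (by simp [SimpleGraph.IsIndepSet])
      simpa using h
    have hposR : ∀ n, (0 : ℝ) < ((strongPow G n).indepNum : ℝ) := fun n => by
      exact_mod_cast hpos n
    have hle : ∀ n, (strongPow G n).indepNum ≤ Fintype.card V ^ n := fun n => by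
      obtain ⟨s, hs⟩ := (strongPow G n).exists_isNIndepSet_indepNum
      rw [← hs.card_eq]
      simpa using s.card_le_univ
    let u : ℕ → ℝ := fun n => -Real.log ((strongPow G n).indepNum : ℝ)
    have hu : Subadditive u := fun m n => by
      have h : ((strongPow G m).indepNum : ℝ) * ((strongPow G n).indepNum : ℝ)
          ≤ ((strongPow G (m + n)).indepNum : ℝ) := by
        exact_mod_cast indepNum_strongPow_mul_le G m n
      have h' := Real.log_le_log (mul_pos (hposR m) (hposR n)) h
      rw [Real.log_mul (hposR m).ne' (hposR n).ne'] at h'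
      simp only [u]
      linarith
    have hbdd : BddBelow (Set.range fun n => u n / n) := by
      refine ⟨-Real.log (Fintype.card V), ?_⟩
      rintro _ ⟨n, rfl⟩
      have hlog : 0 ≤ Real.log (Fintype.card V : ℝ) :=
        Real.log_natCast_nonneg _
      rcases Nat.eq_zero_or_pos n with rfl | hn
      · simpa using hlog
      have hn' : (0 : ℝ) < n := by exact_mod_cast hn
      have h : Real.log ((strongPow G n).indepNum : ℝ) ≤ n * Real.log (Fintype.card V) := by
        rw [← Real.log_pow]
        exact Real.log_le_log (hposR n) (by exact_mod_cast hle n)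
      simp only [u]
      rw [le_div_iff₀ hn']
      linarith
    refine ⟨Real.exp (-hu.lim), ?_⟩
    refine ((Real.continuous_exp.tendsto _).comp (hu.tendsto_lim hbdd).neg).congr fun n => ?_
    rw [Real.rpow_def_of_pos (hposR n)]
    simp only [Function.comp_apply, u]
    congr 1
    ring

/-! Words of an independent set of `strongPow G n` stay apart after replacing each letter `v` by an
arbitrary element of `f v`, for `f ∈ assignments H G`; if every `f v` has at least `c` elements,
this gives `c ^ n α(G^n) ≤ α(H^n)`, hence `c 𝒞(G) ≤ 𝒞(H)`. Grouping the `4 k + 2` points into pairs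
placed around `C_{2 k + 1}`, the four triples inside two consecutive pairs realise `c = 4` for
`H = J(4 k + 2, 3)`. Conversely, the Gram matrix over `𝔽₂` of the triples shows
`𝒞(J(n, 3)) ≤ ℋ(J(n, 3)) ≤ n`.

If every `f v` had five elements, then `25 α(C_{2 k + 1}²) ≤ (4 k + 2)²`. For `2 k + 1 ≥ 5` this
contradicts `α(C_5²) ≥ 5`, since a homomorphism `C_m → C_p` transports densities of independent
sets: averaging over translates, `p ^ n α(C_m^n) ≥ m ^ n α(C_p^n)`. For `k = 1`, the independent
sets of `J(6, 3)` have at most four elements.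

It remains to find independent sets in powers of odd cycles. For `p = 2 ^ (e + 1) k + 1` a lattice
in `(ℤ/p)^(e + 1)` with `k p ^ e` points gives `𝒞(C_p) ≥ p / 2 - 1 / (e + 1)`, and the
homomorphisms extend this to all long odd cycles. The lattice bound also settles `C_9`, and `C_11`
by transport from `C_9`; `C_13` is settled by a cyclic subgroup of `(ℤ/247)³`, and `C_7` by an
explicit set of 367 words of length 5. All four lower bounds for `𝒞(J(n, 3))` exceed `n - 1`,
whence `ℋ(J(n, 3)) = n`. -/

/-- Two letters of the channel with confusion graph `G` are confusable if they are equal or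
adjacent. A set of words in `strongPow G n` is independent iff distinct words of it differ by
unconfusable letters in some position. -/
def Confusable {V : Type*} (G : SimpleGraph V) (u v : V) : Prop := u = v ∨ G.Adj u v

section IndependentSets

variable {V W : Type*} {G : SimpleGraph V} {H : SimpleGraph W} {u v : V} {n : ℕ}

theorem Confusable.refl (u : V) : Confusable G u u := Or.inl rfl

theorem Confusable.symm (h : Confusable G u v) : Confusable G v u :=
  h.imp Eq.symm SimpleGraph.Adj.symm

theorem Confusable.map (h : Confusable G u v) (φ : G →g H) : Confusable H (φ u) (φ v) :=
  h.imp (congrArg φ) φ.map_adj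

theorem Confusable.eq_of_map_eq (h : Confusable G u v) (φ : G →g H) (hφ : φ u = φ v) : u = v :=
  h.resolve_right fun hadj => (φ.map_adj hadj).ne hφ

theorem Confusable.eq_of_isIndepSet (h : Confusable G u v) {S : Set V} (hS : G.IsIndepSet S)
    (hu : u ∈ S) (hv : v ∈ S) : u = v :=
  h.elim id fun hadj => by_contra fun hne => hS hu hv hne hadj

theorem isIndepSet_strongPow_iff {S : Set (Fin n → V)} :
    (strongPow G n).IsIndepSet S ↔
      ∀ x ∈ S, ∀ y ∈ S, (∀ i, Confusable G (x i) (y i)) → x = y :=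
  ⟨fun hS _ hx _ hy hxy => by_contra fun hne => hS hx hy hne ⟨hne, hxy⟩,
    fun h x hx y hy hne hadj => hne (h x hx y hy hadj.2)⟩

theorem exists_finset_card_eq_indepNum_strongPow [Finite V] (G : SimpleGraph V) (n : ℕ) :
    ∃ S : Finset (Fin n → V), S.card = (strongPow G n).indepNum ∧
      ∀ x ∈ S, ∀ y ∈ S, (∀ i, Confusable G (x i) (y i)) → x = y := by
  obtain ⟨S, hS⟩ := (strongPow G n).exists_isNIndepSet_indepNum
  exact ⟨S, hS.card_eq, isIndepSet_strongPow_iff.1 hS.isIndepSet⟩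

theorem card_le_indepNum_strongPow [Finite V] {ι : Type*} [Fintype ι] {g : ι → Fin n → V}
    (hg : ∀ p q, (∀ i, Confusable G (g p i) (g q i)) → p = q) :
    Fintype.card ι ≤ (strongPow G n).indepNum := by
  classical
  have hinj : Function.Injective g := fun p q h => hg p q fun i => h ▸ Confusable.refl _
  have hind : (strongPow G n).IsIndepSet (Finset.univ.image g : Finset (Fin n → V)) := by
    rw [isIndepSet_strongPow_iff, Finset.coe_image]
    rintro _ ⟨p, -, rfl⟩ _ ⟨q, -, rfl⟩ h
    rw [hg p q h]
  simpa only [Finset.card_image_of_injective _ hinj, Finset.card_univ]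
    using hind.card_le_indepNum

theorem length_le_indepNum_strongPow [Finite V] {l : List (Fin n → V)}
    (hl : l.Pairwise fun x y => ∃ i, ¬ Confusable G (x i) (y i)) :
    l.length ≤ (strongPow G n).indepNum := by
  rw [← Fintype.card_fin l.length]
  refine card_le_indepNum_strongPow (g := l.get) fun p q hpq => ?_
  rcases lt_trichotomy p q with h | h | h
  · obtain ⟨i, hi⟩ := List.pairwise_iff_get.1 hl p q h
    exact absurd (hpq i) hi
  · exact h
  · obtain ⟨i, hi⟩ := List.pairwise_iff_get.1 hl q p h
    exact absurd (hpq i).symm hi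

theorem pow_indepNum_strongPow_le [Finite V] (G : SimpleGraph V) (d n : ℕ) :
    (strongPow G d).indepNum ^ n ≤ (strongPow G (d * n)).indepNum := by
  induction n with
  | zero =>
    simpa using card_le_indepNum_strongPow (G := G) (g := fun _ : Unit => (Fin.elim0 : Fin 0 → V))
      fun _ _ _ => rfl
  | succ n ih =>
    calc (strongPow G d).indepNum ^ (n + 1)
        ≤ (strongPow G (d * n)).indepNum * (strongPow G d).indepNum :=
          Nat.mul_le_mul_right _ ih
      _ ≤ (strongPow G (d * (n + 1))).indepNum := indepNum_strongPow_mul_le G _ _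

theorem confusable_of_mem_assignments {f : V → Finset W} (hf : f ∈ assignments H G) {x y : W}
    (hx : x ∈ f u) (hy : y ∈ f v) (hxy : Confusable H x y) : Confusable G u v := by
  by_contra huv
  obtain ⟨hne, hadj⟩ := not_or.1 huv
  obtain ⟨hdisj, hind⟩ := hf.2 u v hne hadj
  have heq : x = y := hxy.eq_of_isIndepSet hind (Or.inl hx) (Or.inr hy)
  exact Finset.disjoint_left.1 hdisj hx (heq ▸ hy)

theorem pow_mul_indepNum_le_of_mem_assignments [Finite V] [Finite W] {f : V → Finset W}
    (hf : f ∈ assignments H G) {c : ℕ} (hc : ∀ v, c ≤ (f v).card) (n : ℕ) :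
    c ^ n * (strongPow G n).indepNum ≤ (strongPow H n).indepNum := by
  obtain ⟨S, hcard, hS⟩ := exists_finset_card_eq_indepNum_strongPow G n
  have hsep : ∀ p q : Σ s : S, ∀ i, f (s.1 i),
      (∀ i, Confusable H (p.2 i).1 (q.2 i).1) → p = q := by
    rintro ⟨⟨s, hs⟩, x⟩ ⟨⟨t, ht⟩, y⟩ hxy
    obtain rfl : s = t := hS s hs t ht fun i =>
      confusable_of_mem_assignments hf (x i).2 (y i).2 (hxy i)
    obtain rfl : x = y := funext fun i =>
      Subtype.ext ((hxy i).eq_of_isIndepSet (hf.1 (s i)) (x i).2 (y i).2)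
    rfl
  calc c ^ n * (strongPow G n).indepNum = ∑ _s : S, ∏ _i : Fin n, c := by
        simp [hcard, mul_comm]
    _ ≤ ∑ s : S, ∏ i, (f (s.1 i)).card :=
        Finset.sum_le_sum fun s _ => Finset.prod_le_prod' fun i _ => hc (s.1 i)
    _ = Fintype.card (Σ s : S, ∀ i, f (s.1 i)) := by simp
    _ ≤ (strongPow H n).indepNum :=
        card_le_indepNum_strongPow (g := fun p i => (p.2 i).1) hsep

theorem card_translate_le_indepNum_strongPow [Finite V] [Add W] [IsLeftCancelAdd W]
    (htrans : ∀ a u v, H.Adj u v → H.Adj (a + u) (a + v)) (φ : G →g H)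
    {S : Finset (Fin n → W)}
    (hS : ∀ x ∈ S, ∀ y ∈ S, (∀ i, Confusable H (x i) (y i)) → x = y) (t : Fin n → W)
    [Fintype {x : Fin n → V // (fun i => t i + φ (x i)) ∈ S}] :
    Fintype.card {x : Fin n → V // (fun i => t i + φ (x i)) ∈ S} ≤
      (strongPow G n).indepNum := by
  refine card_le_indepNum_strongPow (g := Subtype.val) fun x y hxy => ?_
  have heq := hS _ x.2 _ y.2 fun i =>
    ((hxy i).map φ).imp (congrArg (t i + ·)) (htrans (t i) _ _)
  exact Subtype.ext (funext fun i =>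
    (hxy i).eq_of_map_eq φ (add_left_cancel (congrFun heq i)))

theorem card_pow_mul_indepNum_le_of_hom [Fintype V] [AddGroup W] [Fintype W]
    (htrans : ∀ a u v, H.Adj u v → H.Adj (a + u) (a + v)) (φ : G →g H) (n : ℕ) :
    Fintype.card V ^ n * (strongPow H n).indepNum ≤
      Fintype.card W ^ n * (strongPow G n).indepNum := by
  classical
  obtain ⟨S, hcard, hS⟩ := exists_finset_card_eq_indepNum_strongPow H n
  let R (t : Fin n → W) (x : Fin n → V) : Prop := (fun i => t i + φ (x i)) ∈ S
  have hshift (x : Fin n → V) : Fintype.card {t // R t x} = S.card := by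
    rw [← Fintype.card_coe S]
    exact Fintype.card_congr ((Equiv.addRight fun i => φ (x i)).subtypeEquiv fun _ => Iff.rfl)
  calc Fintype.card V ^ n * (strongPow H n).indepNum
      = ∑ x : Fin n → V, Fintype.card {t // R t x} := by simp [hshift, hcard]
    _ = ∑ t : Fin n → W, Fintype.card {x // R t x} := by
        simp only [Fintype.card_subtype]
        exact (Finset.sum_card_bipartiteAbove_eq_sum_card_bipartiteBelow R).symm
    _ ≤ ∑ _t : Fin n → W, (strongPow G n).indepNum :=
        Finset.sum_le_sum fun t _ => card_translate_le_indepNum_strongPow htrans φ hS t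
    _ = Fintype.card W ^ n * (strongPow G n).indepNum := by simp

end IndependentSets

section Capacity

variable {V W : Type*}

theorem le_shannonCapacity_of_pow_le [Finite V] (G : SimpleGraph V) {d : ℕ} (hd : 0 < d) {y : ℝ}
    (hy : 0 ≤ y) (h : y ^ d ≤ (strongPow G d).indepNum) : y ≤ shannonCapacity G := by
  have hsub : Tendsto (fun n : ℕ => d * n) atTop atTop := tendsto_id.const_mul_atTop' hd
  refine ge_of_tendsto ((tendsto_shannonCapacity G).comp hsub) ?_
  filter_upwards [eventually_ge_atTop 1] with n hn
  have hpow : y ^ (d * n) ≤ (strongPow G (d * n)).indepNum :=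
    calc y ^ (d * n) = (y ^ d) ^ n := pow_mul y d n
      _ ≤ ((strongPow G d).indepNum : ℝ) ^ n := pow_le_pow_left₀ (by positivity) h n
      _ ≤ (strongPow G (d * n)).indepNum := by exact_mod_cast pow_indepNum_strongPow_le G d n
  calc y = (y ^ (d * n)) ^ (1 / ((d * n : ℕ) : ℝ)) := by
        rw [one_div, Real.pow_rpow_inv_natCast hy (by positivity)]
    _ ≤ ((strongPow G (d * n)).indepNum : ℝ) ^ (1 / ((d * n : ℕ) : ℝ)) :=
        Real.rpow_le_rpow (by positivity) hpow (by positivity)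

theorem shannonCapacity_le_of_le_pow [Finite V] (G : SimpleGraph V) {r : ℕ}
    (h : ∀ n, (strongPow G n).indepNum ≤ r ^ n) : shannonCapacity G ≤ r := by
  refine le_of_tendsto (tendsto_shannonCapacity G) ?_
  filter_upwards [eventually_ge_atTop 1] with n hn
  calc ((strongPow G n).indepNum : ℝ) ^ (1 / (n : ℝ)) ≤ ((r : ℝ) ^ n) ^ (1 / (n : ℝ)) :=
        Real.rpow_le_rpow (by positivity) (by exact_mod_cast h n) (by positivity)
    _ = r := by rw [one_div, Real.pow_rpow_inv_natCast (by positivity) (by omega)]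

theorem mul_shannonCapacity_le_mul [Finite V] [Finite W] (G : SimpleGraph V) (H : SimpleGraph W)
    {a b : ℕ}
    (h : ∀ n, a ^ n * (strongPow G n).indepNum ≤ b ^ n * (strongPow H n).indepNum) :
    a * shannonCapacity G ≤ b * shannonCapacity H := by
  refine le_of_tendsto_of_tendsto ((tendsto_shannonCapacity G).const_mul (a : ℝ))
    ((tendsto_shannonCapacity H).const_mul (b : ℝ)) ?_
  filter_upwards [eventually_ge_atTop 1] with n hn
  have hroot (c α : ℕ) :
      (c : ℝ) * (α : ℝ) ^ (1 / (n : ℝ)) = ((c : ℝ) ^ n * α) ^ (1 / (n : ℝ)) := by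
    rw [Real.mul_rpow (by positivity) (by positivity), one_div,
      Real.pow_rpow_inv_natCast (by positivity) (by omega)]
  rw [hroot, hroot]
  exact Real.rpow_le_rpow (by positivity) (by exact_mod_cast h n) (by positivity)

end Capacity

section Haemers

variable {V K : Type*} [Fintype V] [Field K]

theorem exists_eq_mul_of_rank {m : Type*} [Finite m] (B : Matrix m V K) :
    ∃ (P : Matrix m (Fin B.rank) K) (Q : Matrix (Fin B.rank) V K), B = P * Q := by
  classical
  let b := Module.finBasisOfFinrankEq K (LinearMap.range B.mulVecLin) (n := B.rank) rfl
  let column (j : V) : LinearMap.range B.mulVecLin :=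
    ⟨B.mulVecLin (Pi.single j 1), LinearMap.mem_range_self _ _⟩
  refine ⟨Matrix.of fun i k => (b k).1 i, Matrix.of fun k j => b.repr (column j) k, ?_⟩
  ext i j
  calc B i j = (column j).1 i := by simp [column]
    _ = (∑ k, b.repr (column j) k • b k).1 i := by rw [b.sum_repr]
    _ = ∑ k, (b k).1 i * b.repr (column j) k := by simp [-Module.Basis.sum_repr, mul_comm]

theorem rank_prod_le_rank_pow {ι : Type*} [Fintype ι] (B : Matrix V V K) {n : ℕ}
    (g : ι → Fin n → V) :
    (Matrix.of fun p q => ∏ i, B (g p i) (g q i)).rank ≤ B.rank ^ n := by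
  classical
  obtain ⟨P, Q, hB⟩ := exists_eq_mul_of_rank B
  let P' : Matrix ι (Fin n → Fin B.rank) K := Matrix.of fun p f => ∏ i, P (g p i) (f i)
  let Q' : Matrix (Fin n → Fin B.rank) ι K := Matrix.of fun f q => ∏ i, Q (f i) (g q i)
  have hfactor : (Matrix.of fun p q => ∏ i, B (g p i) (g q i)) = P' * Q' := by
    ext p q
    calc ∏ i, B (g p i) (g q i) = ∏ i, ∑ k, P (g p i) k * Q k (g q i) :=
          Finset.prod_congr rfl fun i _ => congrFun (congrFun hB (g p i)) (g q i)
      _ = ∑ f : Fin n → Fin B.rank, ∏ i, P (g p i) (f i) * Q (f i) (g q i) :=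
          Fintype.prod_sum _
      _ = (P' * Q') p q := by simp only [Finset.prod_mul_distrib, Matrix.mul_apply, P', Q',
          Matrix.of_apply]
  calc (Matrix.of fun p q => ∏ i, B (g p i) (g q i)).rank = (P' * Q').rank := by rw [hfactor]
    _ ≤ P'.rank := Matrix.rank_mul_le_left _ _
    _ ≤ Fintype.card (Fin n → Fin B.rank) := Matrix.rank_le_card_width _
    _ = B.rank ^ n := by simp

theorem indepNum_strongPow_le_rank_pow {G : SimpleGraph V} {B : Matrix V V K}
    (hdiag : ∀ v, B v v ≠ 0) (hoff : ∀ u v, u ≠ v → ¬ G.Adj u v → B u v = 0) (n : ℕ) :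
    (strongPow G n).indepNum ≤ B.rank ^ n := by
  classical
  obtain ⟨S, hcard, hS⟩ := exists_finset_card_eq_indepNum_strongPow G n
  let M : Matrix S S K := Matrix.of fun x y => ∏ i, B (x.1 i) (y.1 i)
  have hM : M = Matrix.diagonal fun x => ∏ i, B (x.1 i) (x.1 i) := by
    ext x y
    rcases eq_or_ne x y with rfl | hne
    · simp [M]
    · obtain ⟨i, hi⟩ := not_forall.1 fun h => hne (Subtype.ext (hS x x.2 y y.2 h))
      rw [Matrix.diagonal_apply_ne _ hne]
      exact Finset.prod_eq_zero (Finset.mem_univ i) (hoff _ _ (not_or.1 hi).1 (not_or.1 hi).2)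
  have hdet : M.det ≠ 0 := by
    rw [hM, Matrix.det_diagonal]
    exact Finset.prod_ne_zero_iff.2 fun x _ => Finset.prod_ne_zero_iff.2 fun i _ => hdiag _
  calc (strongPow G n).indepNum = M.rank := by
        rw [Matrix.rank_of_det_ne_zero hdet, Fintype.card_coe, hcard]
    _ ≤ B.rank ^ n := rank_prod_le_rank_pow B Subtype.val

theorem indepNum_strongPow_le_haemersNumber_pow (G : SimpleGraph V) (n : ℕ) :
    (strongPow G n).indepNum ≤ haemersNumber G ^ n := by
  classical
  have hne : {r | ∃ (K : Type) (_ : Field K) (B : Matrix V V K),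
      (∀ v, B v v ≠ 0) ∧ (∀ u v, u ≠ v → ¬ G.Adj u v → B u v = 0) ∧ B.rank = r}.Nonempty :=
    ⟨_, ℚ, inferInstance, 1, by simp, fun u v h _ => Matrix.one_apply_ne h, rfl⟩
  obtain ⟨K, _, B, hdiag, hoff, hr⟩ := Nat.sInf_mem hne
  rw [haemersNumber, ← hr]
  exact indepNum_strongPow_le_rank_pow hdiag hoff n

theorem shannonCapacity_le_haemersNumber (G : SimpleGraph V) :
    shannonCapacity G ≤ haemersNumber G :=
  shannonCapacity_le_of_le_pow G (indepNum_strongPow_le_haemersNumber_pow G)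

end Haemers

section Cycles

theorem cycleGraph_adj_iff {m : ℕ} [NeZero m] (hm : 2 ≤ m) {u v : Fin m} :
    (SimpleGraph.cycleGraph m).Adj u v ↔ u = v + 1 ∨ v = u + 1 := by
  obtain ⟨n, rfl⟩ : ∃ n, m = n + 2 := ⟨m - 2, by omega⟩
  rw [SimpleGraph.cycleGraph_adj, sub_eq_iff_eq_add', sub_eq_iff_eq_add', add_comm v, add_comm u]

theorem cycleGraph_adj_iff_val {m : ℕ} (hm : 2 ≤ m) {u v : Fin m} :
    (SimpleGraph.cycleGraph m).Adj u v ↔ u.val = v.val + 1 ∨ v.val = u.val + 1 ∨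
      (u.val = 0 ∧ v.val + 1 = m) ∨ (v.val = 0 ∧ u.val + 1 = m) := by
  have : NeZero m := ⟨by omega⟩
  have hsucc (a b : Fin m) : a = b + 1 ↔ a.val = b.val + 1 ∨ (a.val = 0 ∧ b.val + 1 = m) := by
    rw [Fin.ext_iff, Fin.val_add, Fin.val_one', Nat.add_mod_mod]
    rcases Nat.lt_or_ge (b.val + 1) m with h | h
    · rw [Nat.mod_eq_of_lt h]
      omega
    · have hb : b.val + 1 = m := by omega
      rw [hb, Nat.mod_self]
      omega
  rw [cycleGraph_adj_iff hm, hsucc, hsucc]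
  tauto

theorem Confusable.exists_modEq {m : ℕ} (hm : 2 ≤ m) {u v : Fin m}
    (h : Confusable (SimpleGraph.cycleGraph m) u v) :
    ∃ ε : ℤ, |ε| ≤ 1 ∧ (u.val : ℤ) ≡ v.val + ε [ZMOD m] := by
  rw [Confusable, cycleGraph_adj_iff_val hm] at h
  simp only [Int.modEq_iff_dvd]
  rcases h with rfl | h | h | ⟨h, h'⟩ | ⟨h, h'⟩
  · exact ⟨0, by simp, by simp⟩
  · exact ⟨1, by simp, 0, by omega⟩
  · exact ⟨-1, by simp, 0, by omega⟩
  · exact ⟨1, by simp, 1, by omega⟩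
  · exact ⟨-1, by simp, -1, by omega⟩

theorem nonempty_hom_cycleGraph {p m : ℕ} (hp : 3 ≤ p) (hpm : p ≤ m) (heven : Even (m - p)) :
    Nonempty (SimpleGraph.cycleGraph m →g SimpleGraph.cycleGraph p) := by
  -- Wind once around `C_p`, then walk back and forth along its last edge.
  refine ⟨⟨fun x => ⟨if x.val < p then x.val else if (x.val - p) % 2 = 0 then p - 2 else p - 1,
    by split_ifs <;> omega⟩, fun {u v} h => ?_⟩⟩
  rw [cycleGraph_adj_iff_val (by omega)] at h ⊢
  obtain ⟨r, hr⟩ := heven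
  simp only
  rcases h with h | h | ⟨h, h'⟩ | ⟨h, h'⟩ <;> split_ifs <;> omega

theorem pow_mul_indepNum_cycleGraph_le {p m : ℕ} (hp : 3 ≤ p) (hpm : p ≤ m)
    (heven : Even (m - p)) (n : ℕ) :
    m ^ n * (strongPow (SimpleGraph.cycleGraph p) n).indepNum ≤
      p ^ n * (strongPow (SimpleGraph.cycleGraph m) n).indepNum := by
  have : NeZero p := ⟨by omega⟩
  obtain ⟨φ⟩ := nonempty_hom_cycleGraph hp hpm heven
  have htrans (a u v : Fin p) (huv : (SimpleGraph.cycleGraph p).Adj u v) :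
      (SimpleGraph.cycleGraph p).Adj (a + u) (a + v) := by
    rw [cycleGraph_adj_iff (by omega)] at huv ⊢
    simpa only [add_assoc, add_right_inj] using huv
  simpa only [Fintype.card_fin] using card_pow_mul_indepNum_le_of_hom htrans φ n

end Cycles

section Lattices

theorem abs_sum_two_pow_mul_lt {d : ℕ} {δ : Fin d → ℤ} (hδ : ∀ i, |δ i| ≤ 1) :
    |∑ i, 2 ^ i.val * δ i| < 2 ^ d := by
  induction d with
  | zero => simp
  | succ d ih =>
    rw [Fin.sum_univ_castSucc]
    simp only [Fin.val_castSucc, Fin.val_last]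
    have hinit : |∑ i : Fin d, (2 : ℤ) ^ i.val * δ i.castSucc| < 2 ^ d := ih fun i => hδ _
    have hlast : |(2 : ℤ) ^ d * δ (Fin.last d)| ≤ 2 ^ d := by
      rw [abs_mul, abs_of_nonneg (by positivity : (0 : ℤ) ≤ 2 ^ d)]
      exact mul_le_of_le_one_right (by positivity) (hδ _)
    calc |∑ i : Fin d, (2 : ℤ) ^ i.val * δ i.castSucc + 2 ^ d * δ (Fin.last d)|
        ≤ |∑ i : Fin d, (2 : ℤ) ^ i.val * δ i.castSucc| + |2 ^ d * δ (Fin.last d)| :=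
          abs_add_le _ _
      _ < 2 ^ (d + 1) := by rw [pow_succ]; linarith

theorem eq_zero_of_sum_two_pow_mul_eq_zero {d : ℕ} {δ : Fin d → ℤ} (hδ : ∀ i, |δ i| ≤ 1)
    (h : ∑ i, 2 ^ i.val * δ i = 0) (i : Fin d) : δ i = 0 := by
  induction d with
  | zero => exact i.elim0
  | succ d ih =>
    rw [Fin.sum_univ_succ] at h
    simp only [Fin.val_zero, pow_zero, one_mul, Fin.val_succ, pow_succ', mul_assoc,
      ← Finset.mul_sum] at h
    have hzero := abs_le.1 (hδ 0)
    exact Fin.cases (by omega) (ih (fun i => hδ i.succ) (by omega)) i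

theorem eq_and_eq_zero_of_two_pow_mul_sub_modEq_zero {d k : ℕ} {a b : Fin k} {δ : Fin d → ℤ}
    (hδ : ∀ i, |δ i| ≤ 1)
    (h : 2 ^ d * ((a.val : ℤ) - b.val) + ∑ i, 2 ^ i.val * δ i ≡ 0 [ZMOD (2 ^ d * k + 1 : ℕ)]) :
    a = b ∧ ∀ i, δ i = 0 := by
  have hsum := abs_lt.1 (abs_sum_two_pow_mul_lt hδ)
  have ha := a.isLt
  have hb := b.isLt
  have hzero : 2 ^ d * ((a.val : ℤ) - b.val) + ∑ i, 2 ^ i.val * δ i = 0 := by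
    refine Int.eq_zero_of_abs_lt_dvd (Int.modEq_zero_iff_dvd.1 h) ?_
    push_cast
    rw [abs_lt]
    constructor <;> nlinarith
  have hab : (a.val : ℤ) - b.val = 0 := by
    by_contra hne
    rcases lt_or_gt_of_ne hne with hlt | hgt <;> nlinarith
  rw [hab, mul_zero, zero_add] at hzero
  exact ⟨Fin.ext (by omega), eq_zero_of_sum_two_pow_mul_eq_zero hδ hzero⟩

theorem two_pow_mul_sub_add_sum_modEq_zero {e : ℕ} {m a b c : ℤ} {x y ε : Fin e → ℤ}
    (hhead : 2 ^ (e + 1) * a + ∑ i, 2 ^ (i.val + 1) * x i ≡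
      2 ^ (e + 1) * b + ∑ i, 2 ^ (i.val + 1) * y i + c [ZMOD m])
    (htail : ∀ i, x i ≡ y i + ε i [ZMOD m]) :
    2 ^ (e + 1) * (a - b) + ∑ i, 2 ^ i.val * (Fin.cons (-c) ε : Fin (e + 1) → ℤ) i ≡
      0 [ZMOD m] := by
  have hsum : ∑ i, 2 ^ (i.val + 1) * x i ≡ ∑ i, 2 ^ (i.val + 1) * (y i + ε i) [ZMOD m] :=
    Int.ModEq.sum fun i _ => (htail i).mul_left _
  have hdiff := (hhead.sub hsum).sub_right
    (2 ^ (e + 1) * b + c - ∑ i : Fin e, 2 ^ (i.val + 1) * ε i)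
  simp only [mul_add, Finset.sum_add_distrib] at hdiff
  convert hdiff using 1
  · simp only [Fin.sum_univ_succ, Fin.cons_zero, Fin.cons_succ, Fin.val_zero, Fin.val_succ]
    ring
  · ring

/-- The word `(2 ^ (e + 1) * a + ∑ i, 2 ^ (i + 1) * y i, y)` over the integers modulo `m`. For
`m = 2 ^ (e + 1) * k + 1` these words form a large independent set in a strong power of `C_m`. -/
def latticeWord (e k m : ℕ) [NeZero m] (p : Fin k × (Fin e → Fin m)) : Fin (e + 1) → Fin m :=
  Fin.cons (Fin.ofNat m (2 ^ (e + 1) * p.1.val + ∑ i, 2 ^ (i.val + 1) * (p.2 i).val)) p.2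

theorem eq_of_confusable_latticeWord {e k m : ℕ} [NeZero m] (hm : m = 2 ^ (e + 1) * k + 1)
    {p q : Fin k × (Fin e → Fin m)}
    (h : ∀ i, Confusable (SimpleGraph.cycleGraph m) (latticeWord e k m p i)
      (latticeWord e k m q i)) : p = q := by
  obtain ⟨a, x⟩ := p
  obtain ⟨b, y⟩ := q
  have htwo : 2 ≤ m := by
    have : 0 < 2 ^ (e + 1) * k := Nat.mul_pos (by positivity) a.pos
    omega
  choose ε hε hmod using fun i => (h i).exists_modEq htwo
  have htail (i : Fin e) : ((x i).val : ℤ) ≡ (y i).val + ε i.succ [ZMOD m] := by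
    simpa only [latticeWord, Fin.cons_succ] using hmod i.succ
  have hhead : 2 ^ (e + 1) * (a.val : ℤ) + ∑ i, 2 ^ (i.val + 1) * ((x i).val : ℤ) ≡
      2 ^ (e + 1) * b.val + ∑ i, 2 ^ (i.val + 1) * ((y i).val : ℤ) + ε 0 [ZMOD m] := by
    simpa [latticeWord, Int.ModEq] using hmod 0
  have hcomb := two_pow_mul_sub_add_sum_modEq_zero hhead htail
  rw [hm] at hcomb
  obtain ⟨rfl, hzero⟩ := eq_and_eq_zero_of_two_pow_mul_sub_modEq_zero
    (Fin.cases (by simpa using hε 0) fun i => by simpa using hε i.succ) hcomb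
  have hxy (i : Fin e) : x i = y i := by
    have hi := htail i
    have hε_zero : ε i.succ = 0 := by simpa using hzero i.succ
    rw [hε_zero, add_zero, Int.natCast_modEq_iff] at hi
    exact Fin.ext (hi.eq_of_lt_of_lt (x i).isLt (y i).isLt)
  rw [funext hxy]

theorem mul_pow_le_indepNum_cycleGraph (e k : ℕ) :
    k * (2 ^ (e + 1) * k + 1) ^ e ≤
      (strongPow (SimpleGraph.cycleGraph (2 ^ (e + 1) * k + 1)) (e + 1)).indepNum := by
  simpa using card_le_indepNum_strongPow
    fun _ _ => eq_of_confusable_latticeWord (e := e) (k := k) rfl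

end Lattices

section ShortCycles

theorem le_indepNum_cycleGraph_five_sq :
    5 ≤ (strongPow (SimpleGraph.cycleGraph 5) 2).indepNum :=
  mul_pow_le_indepNum_cycleGraph 1 1

theorem le_indepNum_cycleGraph_nine_cube :
    81 ≤ (strongPow (SimpleGraph.cycleGraph 9) 3).indepNum :=
  mul_pow_le_indepNum_cycleGraph 2 1

theorem le_indepNum_cycleGraph_eleven_cube :
    148 ≤ (strongPow (SimpleGraph.cycleGraph 11) 3).indepNum := by
  have hnine := le_indepNum_cycleGraph_nine_cube
  have hdensity := pow_mul_indepNum_cycleGraph_le (p := 9) (m := 11) (by norm_num) (by norm_num)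
    (by decide) 3
  omega

theorem mul_sub_lt_of_confusable_div {m N r s : ℕ} (hm : 2 ≤ m) (hN : 0 < N) (hsr : s ≤ r)
    {u v : Fin m} (hu : u.val = m * r / N) (hv : v.val = m * s / N)
    (h : Confusable (SimpleGraph.cycleGraph m) u v) :
    m * (r - s) < 2 * N ∨ m * N < m * (r - s) + 2 * N := by
  obtain ⟨q, rfl⟩ := Nat.exists_eq_add_of_le hsr
  have hvu : v.val ≤ u.val := by
    rw [hu, hv]
    exact Nat.div_le_div_right (Nat.mul_le_mul_left m hsr)
  have hu_lower : N * u.val ≤ m * (s + q) := hu ▸ Nat.mul_div_le _ _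
  have hv_lower : N * v.val ≤ m * s := hv ▸ Nat.mul_div_le _ _
  have hu_upper : m * (s + q) < N * (u.val + 1) := hu ▸ Nat.lt_mul_div_succ _ hN
  have hv_upper : m * s < N * (v.val + 1) := hv ▸ Nat.lt_mul_div_succ _ hN
  rw [Nat.add_sub_cancel_left]
  rw [Confusable, cycleGraph_adj_iff_val hm, Fin.ext_iff] at h
  have hcases : u.val ≤ v.val + 1 ∨ (v.val = 0 ∧ u.val + 1 = m) := by omega
  rcases hcases with hclose | ⟨hv_zero, hu_last⟩
  · left
    have := Nat.mul_le_mul_left N hclose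
    linarith
  · right
    rw [hv_zero] at hv_upper
    have hwrap : N * (u.val + 1) = N * m := by rw [hu_last]
    linarith

theorem not_confusable_div_of_le {m N q s : ℕ} (hm : 2 ≤ m) (hq : q < N) (hs : s < N)
    (hlow : 2 * N ≤ m * q) (hhigh : m * q + 2 * N ≤ m * N) {u v : Fin m}
    (hu : u.val = m * ((q + s) % N) / N) (hv : v.val = m * s / N) :
    ¬ Confusable (SimpleGraph.cycleGraph m) u v := by
  intro h
  have hN : 0 < N := by omega
  rcases Nat.lt_or_ge (q + s) N with hcarry | hcarry
  · rw [Nat.mod_eq_of_lt hcarry] at hu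
    have hclose := mul_sub_lt_of_confusable_div hm hN (Nat.le_add_left s q) hu hv h
    rw [Nat.add_sub_cancel_right] at hclose
    omega
  · rw [Nat.mod_eq_sub_mod hcarry, Nat.mod_eq_of_lt (by omega)] at hu
    have hclose := mul_sub_lt_of_confusable_div hm hN (by omega) hv hu h.symm
    rw [show s - (q + s - N) = N - q by omega, Nat.mul_sub] at hclose
    omega

/-- The `t`-th point `t * a` of a cyclic subgroup of `(ℤ/N)^d`, rounded down to a word over the
integers modulo `m`. Two points with a pair of coordinates at circular distance at least
`2 * N / m` are rounded to words that are not confusable in `C_m`. -/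
def roundedWord (m N : ℕ) [NeZero m] {d : ℕ} (a : Fin d → ℕ) (t : Fin N) (i : Fin d) : Fin m :=
  ⟨m * (a i * t.val % N) / N, Nat.div_lt_of_lt_mul (by
    rw [mul_comm N]
    exact Nat.mul_lt_mul_of_pos_left (Nat.mod_lt _ t.pos) (NeZero.pos m))⟩

theorem le_indepNum_cycleGraph_of_forall_mul_mod {m N d : ℕ} (hm : 2 ≤ m) (a : Fin d → ℕ)
    (ha : ∀ t < N, t ≠ 0 → ∃ i, 2 * N ≤ m * (a i * t % N) ∧ m * (a i * t % N) + 2 * N ≤ m * N) :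
    N ≤ (strongPow (SimpleGraph.cycleGraph m) d).indepNum := by
  have : NeZero m := ⟨by omega⟩
  suffices hinj : ∀ s t : Fin N, s.val < t.val → ¬ ∀ i, Confusable (SimpleGraph.cycleGraph m)
      (roundedWord m N a t i) (roundedWord m N a s i) by
    refine (Fintype.card_fin N).ge.trans (card_le_indepNum_strongPow (g := roundedWord m N a)
      fun t s h => ?_)
    rcases lt_trichotomy s.val t.val with hlt | heq | hgt
    · exact absurd h (hinj s t hlt)
    · exact Fin.ext heq.symm
    · exact absurd (fun i => (h i).symm) (hinj t s hgt)
  intro s t hst h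
  obtain ⟨i, hlow, hhigh⟩ := ha (t.val - s.val) (by omega) (by omega)
  have hmod : (a i * (t.val - s.val) % N + a i * s.val % N) % N = a i * t.val % N := by
    rw [← Nat.add_mod, ← mul_add, Nat.sub_add_cancel hst.le]
  exact not_confusable_div_of_le hm (Nat.mod_lt _ t.pos) (Nat.mod_lt _ t.pos) hlow hhigh
    (by rw [hmod]; rfl) rfl (h i)

theorem le_indepNum_cycleGraph_thirteen_cube :
    247 ≤ (strongPow (SimpleGraph.cycleGraph 13) 3).indepNum :=
  le_indepNum_cycleGraph_of_forall_mul_mod (by norm_num) ![1, 19, 117] (by decide +kernel)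

/-- Decimal encodings of the words of an independent set of size 367 in the fifth strong power of
`C_7`, the size of the set of Polak and Schrijver. It is closed under cyclic shifts of the words;
it was found by computer search, and the list gives one word per orbit of size 5. -/
def heptagonCode : List ℕ :=
  0 :: 33333 :: [102, 214, 234, 346, 451, 553, 665, 1015, 1122, 1354, 1466, 1603, 2035, 2103, 2235,
    2442, 2554, 2666, 3123, 3243, 3355, 3604, 4141, 4261, 4363, 4405, 4624, 5156, 5206, 5311, 5413,
    5425, 5632, 6164, 6226, 6331, 6433, 6545, 11165, 11252, 11322, 11434, 11546, 12415, 12633,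
    13166, 13216, 13323, 13435, 13652, 14236, 14443, 14555, 15244, 15356, 15563, 16252, 16364,
    16625, 22245, 22564, 23253, 23365, 23626, 24634, 25435, 26443, 26555, 33445, 34565, 35366,
    44645, 46566].flatMap fun a => (List.range 5).map fun j => a * 100001 / 10 ^ j % 10 ^ 5

/-- The word over the integers modulo `7` whose letters are the decimal digits of `a`. -/
def digitWord (a : ℕ) (i : Fin 5) : Fin 7 :=
  Fin.ofNat 7 (a / 10 ^ i.val % 10)

set_option maxRecDepth 4000 in
theorem pairwise_heptagonCode :
    heptagonCode.Pairwise fun a b =>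
      (List.range 5).any fun i => ((a / 10 ^ i % 10 + 12 - b / 10 ^ i % 10) % 7).ble 3 := by
  decide +kernel

theorem le_indepNum_cycleGraph_seven_pow_five :
    367 ≤ (strongPow (SimpleGraph.cycleGraph 7) 5).indepNum := by
  have hlen : (heptagonCode.map digitWord).length = 367 := by decide +kernel
  refine hlen.ge.trans (length_le_indepNum_strongPow (List.pairwise_map.2 ?_))
  refine pairwise_heptagonCode.imp fun {a b} h => ?_
  obtain ⟨i, hi, hfar⟩ := List.any_eq_true.1 h
  refine ⟨⟨i, List.mem_range.1 hi⟩, fun hclose => ?_⟩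
  have hfar_le := Nat.le_of_ble_eq_true hfar
  rw [Confusable, cycleGraph_adj_iff_val (by norm_num), Fin.ext_iff] at hclose
  simp only [digitWord, Fin.val_ofNat] at hclose
  omega

end ShortCycles

section Triples

theorem haemersNumber_johnsonThree_le (n : ℕ) : haemersNumber (johnsonThree n) ≤ n := by
  let M : Matrix {s : Finset (Fin n) // s.card = 3} (Fin n) (ZMod 2) :=
    Matrix.of fun s i => if i ∈ s.1 then 1 else 0
  have hgram (s t) : (M * M.transpose) s t = ((s.1 ∩ t.1).card : ZMod 2) := by
    simp [M, Matrix.mul_apply, ← ite_and, Finset.filter_and, Finset.inter_comm]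
  have hrank : (M * M.transpose).rank ≤ n := by
    simpa only [Fintype.card_fin] using
      (Matrix.rank_mul_le_left M M.transpose).trans (Matrix.rank_le_card_width M)
  refine le_trans (Nat.sInf_le ⟨ZMod 2, inferInstance, M * M.transpose, fun s => ?_,
    fun s t hst hadj => ?_, rfl⟩) hrank
  · rw [hgram, Finset.inter_self, s.2]
    decide
  · have hle : (s.1 ∩ t.1).card ≤ 3 := (Finset.card_le_card Finset.inter_subset_left).trans s.2.le
    have hne_one : (s.1 ∩ t.1).card ≠ 1 := hadj
    have hne_three : (s.1 ∩ t.1).card ≠ 3 := fun h => by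
      have hs := Finset.eq_of_subset_of_card_le (Finset.inter_subset_left (s₂ := t.1))
        (s.2.trans h.symm).le
      have ht := Finset.eq_of_subset_of_card_le (Finset.inter_subset_right (s₁ := s.1))
        (t.2.trans h.symm).le
      exact hst (Subtype.ext (hs.symm.trans ht))
    rw [hgram, ZMod.natCast_eq_zero_iff]
    omega

theorem indepNum_strongPow_johnsonThree_le (n d : ℕ) :
    (strongPow (johnsonThree n) d).indepNum ≤ n ^ d :=
  (indepNum_strongPow_le_haemersNumber_pow _ d).trans
    (Nat.pow_le_pow_left (haemersNumber_johnsonThree_le n) d)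

theorem haemersNumber_johnsonThree_eq {n : ℕ} {y : ℝ} (hy : y ≤ shannonCapacity (johnsonThree n))
    (hn : (n : ℝ) - 1 < y) : haemersNumber (johnsonThree n) = n := by
  refine le_antisymm (haemersNumber_johnsonThree_le n) (Nat.lt_succ_iff.1 ?_)
  have h : (n : ℝ) < haemersNumber (johnsonThree n) + 1 := by
    linarith [shannonCapacity_le_haemersNumber (johnsonThree n)]
  exact_mod_cast h

instance (n : ℕ) : DecidableRel (johnsonThree n).Adj :=
  fun s t => inferInstanceAs (Decidable ((s.1 ∩ t.1).card = 1))

theorem card_common_compl_neighbors_johnsonThree_six_le_one :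
    ∀ a b c, (johnsonThree 6)ᶜ.Adj a b → (johnsonThree 6)ᶜ.Adj a c → (johnsonThree 6)ᶜ.Adj b c →
      (Finset.univ.filter fun d => (johnsonThree 6)ᶜ.Adj a d ∧ (johnsonThree 6)ᶜ.Adj b d ∧
        (johnsonThree 6)ᶜ.Adj c d).card ≤ 1 := by
  decide +kernel

theorem card_le_four_of_isIndepSet_johnsonThree_six
    {T : Finset {s : Finset (Fin 6) // s.card = 3}} (hT : (johnsonThree 6).IsIndepSet T) :
    T.card ≤ 4 := by
  rcases Nat.lt_or_ge 2 T.card with hcard | hcard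
  · rw [← SimpleGraph.isClique_compl] at hT
    obtain ⟨a, ha, b, hb, c, hc, hab, hac, hbc⟩ := Finset.two_lt_card.1 hcard
    have hcover : T ⊆ {a, b, c} ∪ Finset.univ.filter fun d => (johnsonThree 6)ᶜ.Adj a d ∧
        (johnsonThree 6)ᶜ.Adj b d ∧ (johnsonThree 6)ᶜ.Adj c d := by
      intro d hd
      simp only [Finset.mem_union, Finset.mem_insert, Finset.mem_singleton, Finset.mem_filter,
        Finset.mem_univ, true_and]
      refine or_iff_not_imp_left.2 fun hnew => ?_
      obtain ⟨hda, hdb, hdc⟩ : d ≠ a ∧ d ≠ b ∧ d ≠ c := by simpa only [not_or] using hnew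
      exact ⟨hT ha hd hda.symm, hT hb hd hdb.symm, hT hc hd hdc.symm⟩
    have hrest := card_common_compl_neighbors_johnsonThree_six_le_one a b c (hT ha hb hab)
      (hT ha hc hac) (hT hb hc hbc)
    have hunion := (Finset.card_le_card hcover).trans (Finset.card_union_le _ _)
    have hthree : ({a, b, c} : Finset _).card ≤ 3 := Finset.card_le_three
    omega
  · omega

end Triples

section Blocks

variable {k : ℕ} {v w : Fin (2 * k + 1)}

/-- The union of the `v`-th and the `(v + 1)`-st of the pairs `{2 i, 2 i + 1}`, the indices of
the pairs being read cyclically. -/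
def cycleBlock (k : ℕ) (v : Fin (2 * k + 1)) : Finset (Fin (4 * k + 2)) :=
  Finset.univ.filter fun x => x.val / 2 = v.val ∨ x.val / 2 = (v + 1).val

/-- The triples inside `cycleBlock k v`, as an independent set of `J(4k + 2, 3)` attached to the
vertex `v` of `C_{2k + 1}`. -/
def cycleTriples (k : ℕ) (v : Fin (2 * k + 1)) :
    Finset {s : Finset (Fin (4 * k + 2)) // s.card = 3} :=
  Finset.univ.filter fun s => s.1 ⊆ cycleBlock k v

theorem mem_cycleTriples {s : {s : Finset (Fin (4 * k + 2)) // s.card = 3}} :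
    s ∈ cycleTriples k v ↔ s.1 ⊆ cycleBlock k v := by
  simp only [cycleTriples, Finset.mem_filter, Finset.mem_univ, true_and]

theorem card_filter_div_two_eq {a : ℕ} (ha : a < 2 * k + 1) :
    (Finset.univ.filter fun x : Fin (4 * k + 2) => x.val / 2 = a).card = 2 := by
  have hpair : (Finset.univ.filter fun x : Fin (4 * k + 2) => x.val / 2 = a) =
      {⟨2 * a, by omega⟩, ⟨2 * a + 1, by omega⟩} := by
    ext x
    simp only [Finset.mem_filter, Finset.mem_univ, true_and, Finset.mem_insert,
      Finset.mem_singleton, Fin.ext_iff]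
    omega
  rw [hpair, Finset.card_pair (by simp [Fin.ext_iff])]

theorem card_cycleBlock (hk : 1 ≤ k) (v : Fin (2 * k + 1)) : (cycleBlock k v).card = 4 := by
  have hne : v.val ≠ (v + 1).val := fun h => by
    have : k = 0 := by simpa using Fin.ext h
    omega
  rw [cycleBlock, Finset.filter_or, Finset.card_union_of_disjoint,
    card_filter_div_two_eq v.isLt, card_filter_div_two_eq (v + 1).isLt]
  exact Finset.disjoint_filter.2 fun x _ h h' => hne (h.symm.trans h')

theorem card_cycleTriples (hk : 1 ≤ k) (v : Fin (2 * k + 1)) : (cycleTriples k v).card = 4 := by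
  have hmap : (cycleTriples k v).map (Function.Embedding.subtype _) =
      Finset.powersetCard 3 (cycleBlock k v) := by
    ext s
    simp [mem_cycleTriples, Finset.mem_powersetCard, and_comm]
  rw [← Finset.card_map (Function.Embedding.subtype _), hmap, Finset.card_powersetCard,
    card_cycleBlock hk]
  rfl

theorem disjoint_cycleBlock (hk : 1 ≤ k) (hne : v ≠ w)
    (hadj : ¬ (SimpleGraph.cycleGraph (2 * k + 1)).Adj v w) :
    Disjoint (cycleBlock k v) (cycleBlock k w) := by
  rw [cycleGraph_adj_iff (by omega), not_or] at hadj
  refine Finset.disjoint_left.2 fun x hx hx' => ?_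
  simp only [cycleBlock, Finset.mem_filter, Finset.mem_univ, true_and] at hx hx'
  rcases hx with h | h <;> rcases hx' with h' | h' <;> have heq := Fin.ext (h.symm.trans h')
  · exact hne heq
  · exact hadj.1 heq
  · exact hadj.2 heq.symm
  · exact hne (add_right_cancel heq)

theorem not_adj_of_mem_cycleTriples (hk : 1 ≤ k)
    {s t : {s : Finset (Fin (4 * k + 2)) // s.card = 3}} (hs : s ∈ cycleTriples k v)
    (ht : t ∈ cycleTriples k v) : ¬ (johnsonThree (4 * k + 2)).Adj s t := by
  intro (hadj : (s.1 ∩ t.1).card = 1)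
  have hunion := Finset.card_le_card
    (Finset.union_subset (mem_cycleTriples.1 hs) (mem_cycleTriples.1 ht))
  have hcard := Finset.card_union_add_card_inter s.1 t.1
  rw [card_cycleBlock hk] at hunion
  rw [s.2, t.2] at hcard
  omega

theorem cycleTriples_mem_assignments (hk : 1 ≤ k) :
    cycleTriples k ∈
      assignments (johnsonThree (4 * k + 2)) (SimpleGraph.cycleGraph (2 * k + 1)) := by
  refine ⟨fun v s hs t ht _ => not_adj_of_mem_cycleTriples hk hs ht, fun v w hne hadj => ?_⟩
  have hinter {s t} (hs : s ∈ cycleTriples k v) (ht : t ∈ cycleTriples k w) : s.1 ∩ t.1 = ∅ :=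
    Finset.disjoint_iff_inter_eq_empty.1 ((disjoint_cycleBlock hk hne hadj).mono
      (mem_cycleTriples.1 hs) (mem_cycleTriples.1 ht))
  have hcross {s t} (hs : s ∈ cycleTriples k v) (ht : t ∈ cycleTriples k w) :
      ¬ (johnsonThree (4 * k + 2)).Adj s t := by
    simp [johnsonThree, hinter hs ht]
  refine ⟨Finset.disjoint_left.2 fun s hs hs' => ?_, ?_⟩
  · have hempty : s.1 = ∅ := (Finset.inter_self _).symm.trans (hinter hs hs')
    simpa [hempty] using s.2
  · rintro s (hs | hs) t (ht | ht) _
    · exact not_adj_of_mem_cycleTriples hk hs ht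
    · exact hcross hs ht
    · exact fun h => hcross ht hs h.symm
    · exact not_adj_of_mem_cycleTriples hk hs ht

theorem four_mul_shannonCapacity_cycleGraph_le (hk : 1 ≤ k) :
    4 * shannonCapacity (SimpleGraph.cycleGraph (2 * k + 1)) ≤
      shannonCapacity (johnsonThree (4 * k + 2)) := by
  simpa using mul_shannonCapacity_le_mul (a := 4) (b := 1) _ _ fun n => by
    simpa using pow_mul_indepNum_le_of_mem_assignments (cycleTriples_mem_assignments hk)
      (fun v => (card_cycleTriples hk v).ge) n

theorem four_mul_le_shannonCapacity_johnsonThree {d : ℕ} (hk : 1 ≤ k) (hd : 0 < d) {y : ℝ}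
    (hy : 0 ≤ y) {a : ℕ} (ha : a ≤ (strongPow (SimpleGraph.cycleGraph (2 * k + 1)) d).indepNum)
    (hya : y ^ d ≤ a) : 4 * y ≤ shannonCapacity (johnsonThree (4 * k + 2)) := by
  have hcycle := le_shannonCapacity_of_pow_le _ hd hy (hya.trans (Nat.cast_le.2 ha))
  linarith [four_mul_shannonCapacity_cycleGraph_le hk]

theorem ceil_four_mul_shannonCapacity_cycleGraph_le (hk : 1 ≤ k) :
    ⌈4 * shannonCapacity (SimpleGraph.cycleGraph (2 * k + 1))⌉ ≤
      (haemersNumber (johnsonThree (4 * k + 2)) : ℤ) :=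
  Int.ceil_le.2 (mod_cast (four_mul_shannonCapacity_cycleGraph_le hk).trans
    (shannonCapacity_le_haemersNumber _))

end Blocks

section GammaZero

variable {k : ℕ}

theorem exists_card_le_four_of_mem_assignments (hk : 1 ≤ k)
    {f : Fin (2 * k + 1) → Finset {s : Finset (Fin (4 * k + 2)) // s.card = 3}}
    (hf : f ∈ assignments (johnsonThree (4 * k + 2)) (SimpleGraph.cycleGraph (2 * k + 1))) :
    ∃ v, (f v).card ≤ 4 := by
  rcases hk.eq_or_lt with rfl | hk
  · exact ⟨0, card_le_four_of_isIndepSet_johnsonThree_six (hf.1 0)⟩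
  by_contra! hfive
  set α := (strongPow (SimpleGraph.cycleGraph (2 * k + 1)) 2).indepNum
  have hupper : 5 ^ 2 * α ≤ (4 * k + 2) ^ 2 :=
    (pow_mul_indepNum_le_of_mem_assignments hf hfive 2).trans
      (indepNum_strongPow_johnsonThree_le _ 2)
  have hlower : (2 * k + 1) ^ 2 * 5 ≤ 5 ^ 2 * α :=
    (Nat.mul_le_mul_left _ le_indepNum_cycleGraph_five_sq).trans
      (pow_mul_indepNum_cycleGraph_le (by norm_num) (by omega) ⟨k - 2, by omega⟩ 2)
  nlinarith

theorem gammaZero_cycleGraph_johnsonThree (hk : 1 ≤ k) :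
    gammaZero (SimpleGraph.cycleGraph (2 * k + 1)) (johnsonThree (4 * k + 2)) = 1 / 4 := by
  refine le_antisymm ?_ (le_iInf₂ fun f hf => ?_)
  · refine (iInf₂_le _ (cycleTriples_mem_assignments hk)).trans (iSup_le fun v => ?_)
    rw [card_cycleTriples hk, Nat.cast_ofNat]
  · obtain ⟨v, hv⟩ := exists_card_le_four_of_mem_assignments hk hf
    refine le_trans ?_ (le_iSup _ v)
    exact ENNReal.div_le_div_left (by exact_mod_cast hv) 1

end GammaZero

section Limit

theorem one_sub_two_mul_div_pow_le {n : ℕ} (hn : n ≠ 0) {u : ℝ} (hu : 0 ≤ u) (hu' : u ≤ 1 / 2) :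
    (1 - 2 * u / n) ^ n ≤ 1 - u := by
  have hn_one : (1 : ℝ) ≤ n := by exact_mod_cast Nat.one_le_iff_ne_zero.2 hn
  calc (1 - 2 * u / n) ^ n ≤ Real.exp (-(2 * u)) :=
        Real.one_sub_div_pow_le_exp_neg (by linarith)
    _ = (Real.exp (2 * u))⁻¹ := Real.exp_neg _
    _ ≤ (2 * u + 1)⁻¹ := inv_anti₀ (by linarith) (Real.add_one_le_exp _)
    _ ≤ 1 - u := by
      rw [inv_le_iff_one_le_mul₀ (by linarith)]
      nlinarith

theorem half_sub_le_shannonCapacity_cycleGraph (e : ℕ) {k : ℕ} (hk : 1 ≤ k) :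
    ((2 ^ (e + 1) * k + 1 : ℕ) : ℝ) / 2 - 1 / (e + 1) ≤
      shannonCapacity (SimpleGraph.cycleGraph (2 ^ (e + 1) * k + 1)) := by
  set p := 2 ^ (e + 1) * k + 1 with hp
  have hp_two : 2 ≤ p := by
    have : 0 < 2 ^ (e + 1) * k := by positivity
    omega
  have hpR : (2 : ℝ) ≤ p := by exact_mod_cast hp_two
  have hpk : (p : ℝ) - 1 = 2 ^ (e + 1) * k := by rw [hp]; push_cast; ring
  have hy : (p : ℝ) / 2 - 1 / (e + 1) = p / 2 * (1 - 2 * (1 / p) / (e + 1 : ℕ)) := by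
    push_cast
    field_simp
  have hinv : (1 : ℝ) / p ≤ 1 / 2 := one_div_le_one_div_of_le two_pos hpR
  have hpow := one_sub_two_mul_div_pow_le e.succ_ne_zero (by positivity) hinv
  have hfactor : 0 ≤ 1 - 2 * (1 / (p : ℝ)) / (e + 1 : ℕ) := by
    rw [sub_nonneg]
    exact div_le_one_of_le₀ (by push_cast; linarith [Nat.cast_nonneg (α := ℝ) e]) (by positivity)
  rw [hy]
  refine le_shannonCapacity_of_pow_le _ e.succ_pos (by positivity) ?_
  calc ((p : ℝ) / 2 * (1 - 2 * (1 / p) / (e + 1 : ℕ))) ^ (e + 1)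
      ≤ (p / 2) ^ (e + 1) * (1 - 1 / p) := by
        rw [mul_pow]
        exact mul_le_mul_of_nonneg_left hpow (by positivity)
    _ = p ^ e * ((p - 1) / 2 ^ (e + 1)) := by
        rw [div_pow, pow_succ (p : ℝ)]
        field_simp
    _ = ((k * p ^ e : ℕ) : ℝ) := by
        rw [hpk, mul_div_cancel_left₀ _ (by positivity)]
        push_cast
        ring
    _ ≤ _ := Nat.cast_le.2 (mul_pow_le_indepNum_cycleGraph e k)

theorem sub_le_shannonCapacity_cycleGraph {e n : ℕ} (hn : 2 ^ e ≤ n) :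
    (2 * n + 1 : ℝ) / 2 - 2 / (e + 1) ≤
      shannonCapacity (SimpleGraph.cycleGraph (2 * n + 1)) := by
  have hpos : 0 < 2 ^ e := by positivity
  obtain ⟨k, hk⟩ : ∃ k, n / 2 ^ e = k := ⟨_, rfl⟩
  have hk_pos : 1 ≤ k := hk ▸ (Nat.one_le_div_iff hpos).2 hn
  have hkn : 2 ^ e * k ≤ n := hk ▸ Nat.mul_div_le n _
  have hnk : n < 2 ^ e * (k + 1) := hk ▸ Nat.lt_mul_div_succ n hpos
  have hk_le : 2 ^ e ≤ 2 ^ e * k := Nat.le_mul_of_pos_right _ hk_pos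
  obtain ⟨p, hp⟩ : ∃ p, 2 ^ (e + 1) * k + 1 = p := ⟨_, rfl⟩
  have hp_eq : p = 2 * (2 ^ e * k) + 1 := by rw [← hp, pow_succ]; ring
  have hm_le : (2 * n + 1 : ℝ) ≤ p * 2 := by
    rw [mul_add, mul_one] at hnk
    exact_mod_cast (by omega : 2 * n + 1 ≤ p * 2)
  have hp_pos : (0 : ℝ) < p := by exact_mod_cast (by omega : 0 < p)
  have hlattice := half_sub_le_shannonCapacity_cycleGraph e hk_pos
  rw [hp] at hlattice
  have hdensity := mul_shannonCapacity_le_mul (a := 2 * n + 1) (b := p) _ _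
    (pow_mul_indepNum_cycleGraph_le (p := p) (m := 2 * n + 1) (by omega) (by omega)
      ⟨n - 2 ^ e * k, by omega⟩)
  push_cast at hdensity
  refine le_of_mul_le_mul_left ?_ hp_pos
  calc (p : ℝ) * ((2 * n + 1) / 2 - 2 / (e + 1))
      = (2 * n + 1) * (p / 2) - p * 2 * (1 / (e + 1)) := by ring
    _ ≤ (2 * n + 1) * (p / 2) - (2 * n + 1) * (1 / (e + 1)) := by gcongr
    _ = (2 * n + 1) * (p / 2 - 1 / (e + 1)) := by ring
    _ ≤ (2 * n + 1) * shannonCapacity (SimpleGraph.cycleGraph p) := by gcongr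
    _ ≤ p * shannonCapacity (SimpleGraph.cycleGraph (2 * n + 1)) := hdensity

theorem tendsto_sub_shannonCapacity_johnsonThree :
    Tendsto (fun n : ℕ => (4 * (n : ℝ) + 2) - shannonCapacity (johnsonThree (4 * n + 2)))
      atTop (𝓝 0) := by
  rw [Metric.tendsto_atTop]
  intro ε hε
  obtain ⟨e, he⟩ := exists_nat_gt (8 / ε)
  refine ⟨2 ^ e, fun n hn => ?_⟩
  have hupper : shannonCapacity (johnsonThree (4 * n + 2)) ≤ 4 * (n : ℝ) + 2 := by
    exact_mod_cast shannonCapacity_le_of_le_pow _ (indepNum_strongPow_johnsonThree_le (4 * n + 2))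
  have hlower := four_mul_shannonCapacity_cycleGraph_le (Nat.one_le_two_pow.trans hn)
  have hcycle := sub_le_shannonCapacity_cycleGraph hn
  have hsmall : 2 / ((e : ℝ) + 1) < ε / 4 := by
    rw [div_lt_iff₀ hε] at he
    rw [div_lt_iff₀ (by positivity)]
    linarith
  rw [Real.dist_eq, sub_zero, abs_of_nonneg (by linarith)]
  linarith

end Limit

theorem mainTheorem6 :
    (∀ k : ℕ, 1 ≤ k →
      gammaZero (SimpleGraph.cycleGraph (2 * k + 1)) (johnsonThree (4 * k + 2)) = 1 / 4 ∧
      4 * shannonCapacity (SimpleGraph.cycleGraph (2 * k + 1)) ≤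
        shannonCapacity (johnsonThree (4 * k + 2)) ∧
      shannonCapacity (johnsonThree (4 * k + 2)) ≤
        (haemersNumber (johnsonThree (4 * k + 2)) : ℝ) ∧
      ⌈4 * shannonCapacity (SimpleGraph.cycleGraph (2 * k + 1))⌉ ≤
        (haemersNumber (johnsonThree (4 * k + 2)) : ℤ)) ∧
    4 * 3.2578 ≤ shannonCapacity (johnsonThree 14) ∧
    4 * 4.32 ≤ shannonCapacity (johnsonThree 18) ∧
    4 * 5.2895 ≤ shannonCapacity (johnsonThree 22) ∧
    4 * 6.2743 ≤ shannonCapacity (johnsonThree 26) ∧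
    (∀ n : ℕ, n = 14 ∨ n = 18 ∨ n = 22 ∨ n = 26 → haemersNumber (johnsonThree n) = n) ∧
    Tendsto (fun n : ℕ => (4 * (n : ℝ) + 2) - shannonCapacity (johnsonThree (4 * n + 2)))
      atTop (𝓝 0) := by
  have h14 : 4 * 3.2578 ≤ shannonCapacity (johnsonThree 14) :=
    four_mul_le_shannonCapacity_johnsonThree (k := 3) (by norm_num) (by norm_num) (by norm_num)
      le_indepNum_cycleGraph_seven_pow_five (by norm_num)
  have h18 : 4 * 4.32 ≤ shannonCapacity (johnsonThree 18) :=
    four_mul_le_shannonCapacity_johnsonThree (k := 4) (by norm_num) (by norm_num) (by norm_num)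
      le_indepNum_cycleGraph_nine_cube (by norm_num)
  have h22 : 4 * 5.2895 ≤ shannonCapacity (johnsonThree 22) :=
    four_mul_le_shannonCapacity_johnsonThree (k := 5) (by norm_num) (by norm_num) (by norm_num)
      le_indepNum_cycleGraph_eleven_cube (by norm_num)
  have h26 : 4 * 6.2743 ≤ shannonCapacity (johnsonThree 26) :=
    four_mul_le_shannonCapacity_johnsonThree (k := 6) (by norm_num) (by norm_num) (by norm_num)
      le_indepNum_cycleGraph_thirteen_cube (by norm_num)
  refine ⟨fun k hk => ⟨gammaZero_cycleGraph_johnsonThree hk,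
    four_mul_shannonCapacity_cycleGraph_le hk, shannonCapacity_le_haemersNumber _,
    ceil_four_mul_shannonCapacity_cycleGraph_le hk⟩,
    h14, h18, h22, h26, ?_, tendsto_sub_shannonCapacity_johnsonThree⟩
  rintro n (rfl | rfl | rfl | rfl)
  · exact haemersNumber_johnsonThree_eq h14 (by norm_num)
  · exact haemersNumber_johnsonThree_eq h18 (by norm_num)
  · exact haemersNumber_johnsonThree_eq h22 (by norm_num)
  · exact haemersNumber_johnsonThree_eq h26 (by norm_num)
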